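/- Let $G=(V,E)$ be a finite connected simple graph with a fixed total ordering of its edges, let $v_d\in V$ be a distinguished vertex (the root), and let $m\ge 2$. The generators of the chromatic complex of $G$ over $\mathcal A_m=\mathbb Z[x]/(x^m)$ are the enhanced spanning subgraphs $(H,\epsilon)$, where $H\subseteq E$ and $\epsilon$ assigns to each connected component of the spanning subgraph $(V,H)$ an element of $\{1,x,\dots,x^{m-1}\}$; the homological degree of $(H,\epsilon)$ is $|H|$. The differential is $d(H,\epsilon)=\sum_{e\in E\setminus H}(-1)^{|\{f\in H: f<e\}|}(H\cup e,\epsilon_e)$. Here $\epsilon_e$ multiplies in $\mathcal A_m$ the values of two components that are joined by $e$ and leaves all other values unchanged, and the summand is $0$ if the product is $0$. A broken circuit is a cycle with its smallest edge removed; a set of edges is NBC if it contains no broken circuit. Let $C(\mathrm{NBC})$ be the complex generated by the $(H,\epsilon)$ with $H$ NBC, with the differential restricted to these generators (the summands with $H\cup e$ not NBC are dropped). For a spanning tree $T$, an edge $e\in T$ is internally inactive if it is not the smallest edge of $G$ joining the two components of $T\setminus e$. Let $\mathrm{IN}(T)$ be the set of internally inactive edges of $T$, and $C(\mathrm{IN}(T))$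 the set of connected components of the spanning subgraph $(V,\mathrm{IN}(T))$. An acyclic matching on $C(\mathrm{NBC})$ is a set $\mathcal M$ of pairs of generators $c\to c'$ for which the coefficient $[c:c']$ of $c'$ in the differential of $c$ is invertible, such that no two pairs share a generator, and such that reversing the arrows of $\mathcal M$ in the directed graph with an arrow $c\to c'$ whenever $[c:c']\ne 0$ produces no directed cycle. A generator is critical if it lies in no pair of $\mathcal M$. Then there is an acyclic matching $\mathcal M_{G,m}$ on $C(\mathrm{NBC})$ with the following properties. For every critical generator $(H,\epsilon)$ there is exactly one NBC spanning tree $T$ with $\mathrm{IN}(T)\subseteq H\subseteq T$; we say that $(H,\epsilon)$ belongs to $T$. For every NBC spanning tree $T$, the critical generators that belong to $T$ are exactly the $(\mathrm{IN}(T),f)$, where $f:C(\mathrm{IN}(T))\to\{1,x,\dots,x^{m-1}\}$ is any map with values in $\{x,\dots,x^{m-1}\}$ on all components that do not contain $v_d$. In particular, exactly $m(m-1)^{|C(\mathrm{IN}(T))|-1}$ critical generators belong to $T$. -/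

import Mathlib

/-- A cochain complex of free `R`-modules with a chosen graded basis `Ω`: the degree `i` part is
spanned by the basis elements of degree `i`. -/
structure BasedComplex (R : Type*) [Ring R] where
  /-- the chosen basis -/
  Ω : Type*
  /-- homological degree of a basis element -/
  deg : Ω → ℕ
  /-- the differential -/
  d : (Ω →₀ R) →ₗ[R] (Ω →₀ R)
  /-- the differential raises the degree by one -/
  deg_of_ne : ∀ c c' : Ω, d (Finsupp.single c 1) c' ≠ 0 → deg c' = deg c + 1
  d_comp_d : d ∘ₗ d = 0

namespace BasedComplex

variable {R : Type*} [Ring R] (K : BasedComplex R)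

/-- The incidence number `[c : c']`, the coefficient of `c'` in `d c`. -/
noncomputable def inc (c c' : K.Ω) : R := K.d (Finsupp.single c 1) c'

/-- The directed graph of the complex: an arrow `c → c'` whenever `[c : c'] ≠ 0`. -/
def graph : Digraph K.Ω where
  Adj c c' := K.inc c c' ≠ 0

/-- The graph obtained by reversing the arrows that lie in `M`. -/
def reversedGraph (M : Set (K.Ω × K.Ω)) : Digraph K.Ω where
  Adj c c' := (K.graph.Adj c c' ∧ (c, c') ∉ M) ∨ (c', c) ∈ M

/-- An acyclic matching: a set of arrows, no two incident on a common vertex, all of invertible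
weight, such that reversing them leaves no directed cycle. -/
structure IsAcyclicMatching (M : Set (K.Ω × K.Ω)) : Prop where
  adj : ∀ p ∈ M, K.graph.Adj p.1 p.2
  disjoint : ∀ p ∈ M, ∀ q ∈ M, p ≠ q →
    p.1 ≠ q.1 ∧ p.1 ≠ q.2 ∧ p.2 ≠ q.1 ∧ p.2 ≠ q.2
  isUnit : ∀ p ∈ M, IsUnit (K.inc p.1 p.2)
  acyclic : ∀ c, ¬ Relation.TransGen (K.reversedGraph M).Adj c c

/-- A basis element is critical if it lies on no arrow of `M`. -/
def IsCritical (M : Set (K.Ω × K.Ω)) (c : K.Ω) : Prop :=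
  ∀ p ∈ M, p.1 ≠ c ∧ p.2 ≠ c

theorem d_apply_eq_zero (S : Set K.Ω) (hS : ∀ c c', K.inc c c' ≠ 0 → c' ∈ S → c ∈ S)
    (y : K.Ω →₀ R) (hy : ∀ c ∈ S, y c = 0) (c' : K.Ω) (hc' : c' ∈ S) : K.d y c' = 0 := by
  classical
  rw [← Finsupp.sum_single y, Finsupp.sum, map_sum, Finsupp.finsetSum_apply]
  refine Finset.sum_eq_zero fun c hc => ?_
  have h1 : Finsupp.single c (y c) = y c • Finsupp.single c (1 : R) := by simp
  rw [h1, map_smul, Finsupp.smul_apply]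
  by_cases h : K.inc c c' = 0
  · rw [show K.d (Finsupp.single c 1) c' = 0 from h, smul_zero]
  · rw [hy c (hS c c' h hc'), zero_smul]

/-- The complex spanned by a set `S` of basis elements that contains, with `c'`, every `c` with
`[c : c'] ≠ 0`. Its differential is the restriction of `d`, where the basis elements outside `S`
are dropped. -/
noncomputable def restrict (S : Set K.Ω)
    (hS : ∀ c c', K.inc c c' ≠ 0 → c' ∈ S → c ∈ S) : BasedComplex R where
  Ω := S
  deg c := K.deg c
  d := Finsupp.lsubtypeDomain S ∘ₗ K.d ∘ₗ Finsupp.lmapDomain R R (Subtype.val : S → K.Ω)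
  deg_of_ne c c' h := by
    apply K.deg_of_ne
    have h2 : K.d (Finsupp.lmapDomain R R (Subtype.val : S → K.Ω) (Finsupp.single c 1)) c' ≠ 0 := h
    simpa using h2
  d_comp_d := by
    ext1 c
    ext c'
    set z := K.d (Finsupp.single (c : K.Ω) 1) with hz
    have h0 : K.d z = 0 := by
      have := LinearMap.congr_fun K.d_comp_d (Finsupp.single (c : K.Ω) 1)
      simpa using this
    have h1 := K.d_apply_eq_zero S hS
      (Finsupp.mapDomain Subtype.val (Finsupp.subtypeDomain (· ∈ S) z) - z) (by
        intro a ha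
        have := Finsupp.mapDomain_apply (f := (Subtype.val : S → K.Ω)) Subtype.val_injective
          (Finsupp.subtypeDomain (· ∈ S) z) ⟨a, ha⟩
        rw [Finsupp.sub_apply, sub_eq_zero]
        exact this) c' c'.2
    rw [map_sub, h0, sub_zero] at h1
    have h2 : Finsupp.mapDomain (Subtype.val : S → K.Ω) (Finsupp.single c (1 : R)) =
        Finsupp.single (c : K.Ω) 1 := Finsupp.mapDomain_single
    change K.d (Finsupp.mapDomain Subtype.val (Finsupp.subtypeDomain (· ∈ S)
      (K.d (Finsupp.mapDomain Subtype.val (Finsupp.single c 1))))) c' = 0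
    rw [h2]
    exact h1

end BasedComplex

namespace Chromatic

/-!
An ordering of the edges of a finite graph `G` is given by an injective numbering
`ord : G.edgeSet ↪ ℕ`: the edge `e` is smaller than `f` if `ord e < ord f`.
-/

variable {V : Type*} {G : SimpleGraph V}

/-- The spanning subgraph of `G` with edge set `H`. -/
def sub (H : Set G.edgeSet) : SimpleGraph V :=
  SimpleGraph.fromEdgeSet (Subtype.val '' H)

/-- The connected components of the spanning subgraph with edge set `H`. -/
abbrev Comp (H : Set G.edgeSet) : Type _ := (sub H).ConnectedComponent

variable (G) in
/-- An enhanced spanning subgraph: a set of edges and a colouring of the components of the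
spanning subgraph by `1, x, …, x ^ (m - 1)`; the colour `x ^ i` is recorded by `i : Fin m`. -/
structure State (m : ℕ) where
  edges : Set G.edgeSet
  enh : Comp edges → Fin m

theorem sub_mono {H H' : Set G.edgeSet} (h : H ⊆ H') : sub H ≤ sub H' :=
  SimpleGraph.fromEdgeSet_mono (Set.image_mono h)

theorem supp_subset_iff {H H' : Set G.edgeSet} (h : H ⊆ H') (C : Comp H) (C' : Comp H') :
    C.supp ⊆ C'.supp ↔ C.map (SimpleGraph.Hom.ofLE (sub_mono h)) = C' := by
  induction C using SimpleGraph.ConnectedComponent.ind with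
  | h v =>
    constructor
    · intro hs
      exact hs (a := v) rfl
    · rintro rfl w hw
      have hw : (sub H).connectedComponentMk w = (sub H).connectedComponentMk v := hw
      change (sub H').connectedComponentMk w = (sub H').connectedComponentMk v
      rw [SimpleGraph.ConnectedComponent.eq] at hw ⊢
      exact hw.mono (sub_mono h)

section Complex

variable [Fintype V]

open Classical in
/-- For `s.edges ⊆ H'`, the product of the colours of all components of `s` that are contained in
the component `C'` of `H'` is the monomial with this exponent. -/
noncomputable def exponent {m : ℕ} (s : State G m) (H' : Set G.edgeSet) (C' : Comp H') : ℕ :=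
  ∑ C : Comp s.edges with C.supp ⊆ C'.supp, (s.enh C : ℕ)

open Classical in
/-- Enlarging the edge set of `s` to `H'`: the colours of the components that become connected are
multiplied in `ℤ[x] / (x ^ m)`. If one of these products vanishes, the result is `0`. For
`H' = insert e s.edges` at most two components become connected, and the others keep their
colour. -/
noncomputable def push {m : ℕ} (s : State G m) (H' : Set G.edgeSet) : State G m →₀ ℤ :=
  if h : ∀ C', exponent s H' C' < m then
    Finsupp.single ⟨H', fun C' => ⟨exponent s H' C', h C'⟩⟩ 1
  else 0

/-- The sign with which the edge `e` is added to `H`. -/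
noncomputable def sign (ord : G.edgeSet ↪ ℕ) (H : Set G.edgeSet) (e : G.edgeSet) : ℤ :=
  (-1) ^ {f ∈ H | ord f < ord e}.ncard

open Classical in
/-- The differential of the chromatic complex on a generator. -/
noncomputable def dState (ord : G.edgeSet ↪ ℕ) {m : ℕ} (s : State G m) : State G m →₀ ℤ :=
  ∑ e : G.edgeSet, if e ∈ s.edges then 0 else sign ord s.edges e • push s (insert e s.edges)

/-- The differential of the chromatic complex. -/
noncomputable def diff (ord : G.edgeSet ↪ ℕ) (m : ℕ) :
    (State G m →₀ ℤ) →ₗ[ℤ] (State G m →₀ ℤ) :=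
  Finsupp.linearCombination ℤ (dState ord)

theorem exponent_le {m : ℕ} (s : State G m) {H' H'' : Set G.edgeSet}
    (h'' : H' ⊆ H'') (C' : Comp H') :
    exponent s H' C' ≤ exponent s H'' (C'.map (SimpleGraph.Hom.ofLE (sub_mono h''))) := by
  classical
  refine Finset.sum_le_sum_of_subset fun C hC => ?_
  rw [Finset.mem_filter] at hC ⊢
  exact ⟨hC.1, hC.2.trans ((supp_subset_iff h'' _ _).2 rfl)⟩

theorem exponent_trans {m : ℕ} (s : State G m) {H' H'' : Set G.edgeSet} (h' : s.edges ⊆ H')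
    (h'' : H' ⊆ H'') (h : ∀ C', exponent s H' C' < m) (C'' : Comp H'') :
    exponent (⟨H', fun C' => ⟨exponent s H' C', h C'⟩⟩ : State G m) H'' C'' =
      exponent s H'' C'' := by
  classical
  change (∑ C' : Comp H' with C'.supp ⊆ C''.supp, exponent s H' C') = _
  unfold exponent
  rw [← Finset.sum_fiberwise_of_maps_to
    (s := Finset.univ.filter fun C : Comp s.edges => C.supp ⊆ C''.supp)
    (t := Finset.univ.filter fun C' : Comp H' => C'.supp ⊆ C''.supp)
    (g := fun C => C.map (SimpleGraph.Hom.ofLE (sub_mono h')))]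
  · refine Finset.sum_congr rfl fun C' hC' => Finset.sum_congr ?_ fun _ _ => rfl
    ext C
    simp only [Finset.mem_filter, Finset.mem_univ, true_and] at hC' ⊢
    rw [← supp_subset_iff h']
    exact ⟨fun hC => ⟨hC.trans hC', hC⟩, fun hC => hC.2⟩
  · intro C hC
    simp only [Finset.mem_filter, Finset.mem_univ, true_and] at hC ⊢
    rw [supp_subset_iff (h'.trans h'')] at hC
    rw [supp_subset_iff h'', ← hC]
    induction C using SimpleGraph.ConnectedComponent.ind with
    | h v => rfl

theorem sign_swap (ord : G.edgeSet ↪ ℕ) (H : Set G.edgeSet) {e f : G.edgeSet}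
    (he : e ∉ H) (hef : ord e < ord f) :
    sign ord H e * sign ord (insert e H) f = -(sign ord H f * sign ord (insert f H) e) := by
  classical
  have h1 : {g ∈ insert e H | ord g < ord f} = insert e {g ∈ H | ord g < ord f} := by
    ext g
    simp only [Set.mem_ofPred_eq, Set.mem_insert_iff]
    constructor
    · rintro ⟨rfl | h, h'⟩
      · exact Or.inl rfl
      · exact Or.inr ⟨h, h'⟩
    · rintro (rfl | h)
      · exact ⟨Or.inl rfl, hef⟩
      · exact ⟨Or.inr h.1, h.2⟩
  have h2 : {g ∈ insert f H | ord g < ord e} = {g ∈ H | ord g < ord e} := by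
    ext g
    simp only [Set.mem_ofPred_eq, Set.mem_insert_iff]
    constructor
    · rintro ⟨rfl | h, h'⟩
      · exact absurd h' hef.asymm
      · exact ⟨h, h'⟩
    · exact fun h => ⟨Or.inr h.1, h.2⟩
  unfold sign
  rw [h1, h2, Set.ncard_insert_of_notMem (fun h => he h.1) (Set.toFinite _), pow_succ]
  ring

theorem diff_push (ord : G.edgeSet ↪ ℕ) {m : ℕ} (s : State G m) (H' : Set G.edgeSet)
    (h' : s.edges ⊆ H') : diff ord m (push s H') =
      open Classical in
      ∑ f : G.edgeSet, if f ∈ H' then 0 else sign ord H' f • push s (insert f H') := by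
  classical
  by_cases h : ∀ C', exponent s H' C' < m
  · unfold push
    rw [dif_pos h]
    simp only [diff, Finsupp.linearCombination_single, one_smul, dState]
    refine Finset.sum_congr rfl fun f _ => ?_
    by_cases hf : f ∈ H'
    · simp [hf]
    · simp only [hf, if_false]
      unfold push
      congr 1
      simp only [exponent_trans s h' (Set.subset_insert f H') h]
  · have h0 : ∀ H'', H' ⊆ H'' → push s H'' = 0 := by
      intro H'' h''
      unfold push
      rw [dif_neg]
      intro hh
      exact h fun C' => (exponent_le s h'' C').trans_lt (hh _)
    rw [h0 H' le_rfl, map_zero]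
    symm
    refine Finset.sum_eq_zero fun f _ => ?_
    rw [h0 _ (Set.subset_insert f H'), smul_zero, ite_self]

theorem diff_comp_diff (ord : G.edgeSet ↪ ℕ) (m : ℕ) :
    (diff ord m : (State G m →₀ ℤ) →ₗ[ℤ] _) ∘ₗ diff ord m = 0 := by
  classical
  ext1 s
  ext1
  simp only [LinearMap.comp_apply, Finsupp.lsingle_apply, LinearMap.zero_apply]
  set a : G.edgeSet → G.edgeSet → (State G m →₀ ℤ) := fun e f =>
    if e ∈ s.edges ∨ f ∈ s.edges ∨ e = f then 0 else
      (sign ord s.edges e * sign ord (insert e s.edges) f) •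
        push s (insert f (insert e s.edges)) with ha
  have h1 : diff ord m (diff ord m (Finsupp.single s 1)) = ∑ e, ∑ f, a e f := by
    rw [show diff ord m (Finsupp.single s 1) = dState ord s by simp [diff], dState, map_sum]
    refine Finset.sum_congr rfl fun e _ => ?_
    by_cases he : e ∈ s.edges
    · simp [ha, he]
    · rw [if_neg he, map_smul, diff_push ord s _ (Set.subset_insert e s.edges), Finset.smul_sum]
      refine Finset.sum_congr rfl fun f _ => ?_
      by_cases hf : f ∈ s.edges
      · simp [ha, hf]
      · by_cases hef : e = f
        · simp [ha, hef]
        · simp [ha, he, hf, hef, Ne.symm hef, mul_smul]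
  have h2 : ∀ e f, a e f = -a f e := by
    intro e f
    simp only [ha]
    by_cases he : e ∈ s.edges
    · simp [he]
    by_cases hf : f ∈ s.edges
    · simp [hf]
    rcases lt_trichotomy (ord e) (ord f) with h | h | h
    · have hne : e ≠ f := fun h' => by simp [h'] at h
      simp only [he, hf, hne, hne.symm, or_self, if_false]
      rw [sign_swap ord _ he h, Set.insert_comm, neg_smul]
    · simp [ord.injective h]
    · have hne : e ≠ f := fun h' => by simp [h'] at h
      simp only [he, hf, hne, hne.symm, or_self, if_false]
      rw [sign_swap ord _ hf h, Set.insert_comm, neg_smul, neg_neg]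
  have h3 : ∑ e, ∑ f, a e f = -∑ e, ∑ f, a e f := by
    conv_lhs => rw [Finset.sum_comm]
    rw [← Finset.sum_neg_distrib]
    refine Finset.sum_congr rfl fun e _ => ?_
    rw [← Finset.sum_neg_distrib]
    exact Finset.sum_congr rfl fun f _ => h2 f e
  rw [h1]
  generalize (∑ e, ∑ f, a e f) = x at h3
  ext c
  have := DFunLike.congr_fun h3 c
  rw [Finsupp.neg_apply] at this
  rw [Finsupp.zero_apply]
  omega

theorem exists_of_diff_ne (ord : G.edgeSet ↪ ℕ) {m : ℕ} (s s' : State G m)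
    (h : diff ord m (Finsupp.single s 1) s' ≠ 0) :
    ∃ e, e ∉ s.edges ∧ s'.edges = insert e s.edges := by
  classical
  rw [show diff ord m (Finsupp.single s 1) = dState ord s by simp [diff], dState,
    Finsupp.finsetSum_apply] at h
  obtain ⟨e, -, he⟩ := Finset.exists_ne_zero_of_sum_ne_zero h
  by_cases hs : e ∈ s.edges
  · simp [hs] at he
  refine ⟨e, hs, ?_⟩
  by_contra hne
  apply he
  rw [if_neg hs, Finsupp.smul_apply]
  unfold push
  split_ifs
  · rw [Finsupp.single_apply, if_neg, smul_zero]
    rintro rfl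
    exact hne rfl
  · simp

variable (G) in
/-- The chromatic complex of `G` over `ℤ[x] / (x ^ m)`. -/
noncomputable def chromaticComplex (ord : G.edgeSet ↪ ℕ) (m : ℕ) : BasedComplex ℤ where
  Ω := State G m
  deg s := s.edges.ncard
  d := diff ord m
  deg_of_ne s s' h := by
    obtain ⟨e, he, h'⟩ := exists_of_diff_ne ord s s' h
    rw [h', Set.ncard_insert_of_notMem he (Set.toFinite _)]
  d_comp_d := diff_comp_diff ord m

end Complex

/-- `C` is the edge set of a cycle of `G`. -/
def IsCycleSet (C : Set G.edgeSet) : Prop :=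
  ∃ (v : V) (p : G.Walk v v), p.IsCycle ∧ Subtype.val '' C = {e | e ∈ p.edges}

/-- A broken circuit: a cycle with its smallest edge removed. -/
def IsBrokenCircuit (ord : G.edgeSet ↪ ℕ) (B : Set G.edgeSet) : Prop :=
  ∃ C e, IsCycleSet C ∧ (e ∈ C ∧ ∀ f ∈ C, ord e ≤ ord f) ∧ B = C \ {e}

/-- `H` contains no broken circuit. -/
def IsNBC (ord : G.edgeSet ↪ ℕ) (H : Set G.edgeSet) : Prop :=
  ∀ B, IsBrokenCircuit ord B → ¬ B ⊆ H

/-- `T` is (the edge set of) a spanning tree of `G` without broken circuits. -/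
def IsNBCTree (ord : G.edgeSet ↪ ℕ) (T : Set G.edgeSet) : Prop :=
  (sub T).IsTree ∧ IsNBC ord T

/-- The edges of `G` that reconnect `T` after removal of the edge `e` of the spanning tree `T`. -/
def cut (T : Set G.edgeSet) (e : G.edgeSet) : Set G.edgeSet :=
  {f | (sub (insert f (T \ {e}))).Connected}

/-- `IN(T)`, the set of internally inactive edges of the spanning tree `T`. -/
def internallyInactive (ord : G.edgeSet ↪ ℕ) (T : Set G.edgeSet) : Set G.edgeSet :=
  {e ∈ T | ¬ ∀ f ∈ cut T e, ord e ≤ ord f}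

variable (G) in
/-- The complex generated by the enhanced spanning subgraphs without broken circuits. -/
noncomputable def nbcComplex [Fintype V] (ord : G.edgeSet ↪ ℕ) (m : ℕ) : BasedComplex ℤ :=
  (chromaticComplex G ord m).restrict {s : State G m | IsNBC ord s.edges} (by
    intro s s' h hs' B hB hsub
    obtain ⟨e, -, h'⟩ := exists_of_diff_ne ord s s' h
    refine hs' B hB (hsub.trans ?_)
    rw [h']
    exact Set.subset_insert e s.edges)

/-- The enhanced spanning subgraph underlying a generator of `nbcComplex G ord m`. -/
def nbcState [Fintype V] {ord : G.edgeSet ↪ ℕ} {m : ℕ} (s : (nbcComplex G ord m).Ω) : State G m :=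
  s.1

/-- The critical states that belong to the NBC spanning tree `T`: those whose edge set lies in the
interval `[IN(T), T]`. -/
def criticalStates [Fintype V] {ord : G.edgeSet ↪ ℕ} {m : ℕ}
    (M : Set ((nbcComplex G ord m).Ω × (nbcComplex G ord m).Ω)) (T : Set G.edgeSet) :
    Set (nbcComplex G ord m).Ω :=
  {s | (nbcComplex G ord m).IsCritical M s ∧
    internallyInactive ord T ⊆ (nbcState s).edges ∧ (nbcState s).edges ⊆ T}

end Chromatic

/-!
The matching is built in two layers.

*Intervals.* Every set `H` of edges without broken circuit lies in exactly one interval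
`[IN(T), T]`, where `T` is an NBC tree: `T = minTree ord H` is the lightest connected spanning
subgraph that contains `H`. If an edge `e ∈ T` outside `H` were internally inactive, or if `T`
contained a broken circuit, then an exchange would give a lighter one
(`IsMinSpanning.internallyInactive_subset`, `IsMinSpanning.isNBC`), and the exchange property of
spanning trees gives uniqueness (`IsMinSpanning.eq_of_isTree`). The weight of `minTree ord H` is
monotone in `H`, so the differential never leads back from one interval to an earlier one.

*Inside an interval.* Fix `T`. After the contraction of `IN(T)`, the states with edges in
`[IN(T), T]` are the enhanced spanning subgraphs of a tree, which is rooted at the distinguished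
vertex and whose edges are the internally active edges of `T`. These are processed from the leaves
to the root. An edge is movable if it belongs to the state or if the component of its far endpoint
has the colour `1`; the first movable edge is the pivot. As no edge before the pivot is present,
removing the pivot splits off a single vertex of the contracted tree, and a state that contains its
pivot is matched with the state where the pivot is removed and the vertex gets the colour `1`. The
critical states are those without movable edges: their edge set is `IN(T)`, and every component
except that of the root is the far end of an internally active edge, so that its colour is not `1`
(`exists_reachable_child`).

*Acyclicity.* Adding an edge `e` makes `e` movable and does not change which edges before `e` are
movable (`IsStep.isMovable_iff`). Hence the lexicographic quantity `potential`, made of the weight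
of the tree, the reversed order on pivots, the number of edges other than the pivot, and the
reversed order on degrees, increases along every arrow of the graph in which the matching is
reversed.
-/

namespace Chromatic

variable {V : Type*} {G : SimpleGraph V}

/-! ### Reachability in spanning subgraphs -/

theorem sub_adj {H : Set G.edgeSet} {a b : V} :
    (sub H).Adj a b ↔ ∃ e ∈ H, (e : Sym2 V) = s(a, b) := by
  rw [sub, SimpleGraph.fromEdgeSet_adj]
  constructor
  · rintro ⟨⟨e, he, h⟩, -⟩
    exact ⟨e, he, h⟩
  · rintro ⟨e, he, h⟩
    refine ⟨⟨e, he, h⟩, ?_⟩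
    have h2 : s(a, b) ∈ G.edgeSet := h ▸ e.2
    exact G.ne_of_adj h2

theorem sub_le (H : Set G.edgeSet) : sub H ≤ G := by
  intro a b h
  obtain ⟨e, -, he⟩ := sub_adj.1 h
  have h2 : s(a, b) ∈ G.edgeSet := he ▸ e.2
  exact h2

theorem mem_edgeSet_sub {H : Set G.edgeSet} {e : G.edgeSet} :
    (e : Sym2 V) ∈ (sub H).edgeSet ↔ e ∈ H := by
  obtain ⟨⟨a, b⟩, he⟩ := e
  change s(a, b) ∈ _ ↔ _
  rw [SimpleGraph.mem_edgeSet, sub_adj]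
  constructor
  · rintro ⟨f, hf, h⟩
    have : f = ⟨s(a, b), he⟩ := Subtype.ext h
    exact this ▸ hf
  · exact fun h => ⟨_, h, rfl⟩

theorem sub_univ : sub (Set.univ : Set G.edgeSet) = G := by
  refine le_antisymm (sub_le _) fun a b h => ?_
  exact sub_adj.2 ⟨⟨s(a, b), h⟩, trivial, rfl⟩

theorem sub_sdiff (H : Set G.edgeSet) (e : G.edgeSet) :
    sub (H \ {e}) = (sub H).deleteEdges {(e : Sym2 V)} := by
  ext a b
  rw [SimpleGraph.deleteEdges_adj, sub_adj, sub_adj]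
  constructor
  · rintro ⟨f, ⟨hf, hne⟩, h⟩
    refine ⟨⟨f, hf, h⟩, fun h' => hne ?_⟩
    exact Subtype.ext (h.trans h')
  · rintro ⟨⟨f, hf, h⟩, hne⟩
    refine ⟨f, ⟨hf, ?_⟩, h⟩
    rintro rfl
    exact hne h.symm

theorem exists_eq_mk (e : G.edgeSet) : ∃ a b : V, (e : Sym2 V) = s(a, b) := by
  obtain ⟨⟨a, b⟩, he⟩ := e
  exact ⟨a, b, rfl⟩

theorem reachable_closed {H : Set G.edgeSet} (P : V → Prop)
    (hP : ∀ e ∈ H, ∀ a b, (e : Sym2 V) = s(a, b) → P a → P b) {v w : V}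
    (h : (sub H).Reachable v w) (hv : P v) : P w := by
  obtain ⟨p⟩ := h
  induction p with
  | nil => exact hv
  | cons hadj _ ih =>
    obtain ⟨e, he, h⟩ := sub_adj.1 hadj
    exact ih (hP e he _ _ h hv)

theorem reachable_of_mem {H : Set G.edgeSet} {e : G.edgeSet} (he : e ∈ H) {a b : V}
    (hab : (e : Sym2 V) = s(a, b)) : (sub H).Reachable a b :=
  (sub_adj.2 ⟨e, he, hab⟩).reachable

theorem reachable_of_mem_of_mem {H : Set G.edgeSet} {e : G.edgeSet} (he : e ∈ H) {u v : V}
    (hu : u ∈ (e : Sym2 V)) (hv : v ∈ (e : Sym2 V)) : (sub H).Reachable u v := by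
  obtain ⟨a, b, hab⟩ := exists_eq_mk e
  have h := reachable_of_mem he hab
  rw [hab, Sym2.mem_iff] at hu hv
  rcases hu with rfl | rfl <;> rcases hv with rfl | rfl
  exacts [.rfl, h, h.symm, .rfl]

/-- A new edge does not change the components that contain no endpoint of it. -/
theorem reachable_insert_iff_of_forall_not {H : Set G.edgeSet} {e : G.edgeSet} {v w : V}
    (hv : ∀ u ∈ (e : Sym2 V), ¬ (sub H).Reachable v u) :
    (sub (insert e H)).Reachable v w ↔ (sub H).Reachable v w := by
  refine ⟨fun h => ?_, fun h => h.mono (sub_mono (Set.subset_insert e H))⟩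
  refine reachable_closed (fun w => (sub H).Reachable v w) ?_ h .rfl
  rintro f (rfl | hf) a b hab ha
  · exact absurd ha (hv a (by simp [hab]))
  · exact ha.trans (reachable_of_mem hf hab)

/-- A new edge joins the components of its endpoints. -/
theorem reachable_insert_iff {H : Set G.edgeSet} {e : G.edgeSet} {a b v : V}
    (hab : (e : Sym2 V) = s(a, b)) : (sub (insert e H)).Reachable a v ↔
      (sub H).Reachable a v ∨ (sub H).Reachable b v := by
  constructor
  · intro h
    refine reachable_closed (fun v => (sub H).Reachable a v ∨ (sub H).Reachable b v) ?_ h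
      (Or.inl .rfl)
    rintro f (rfl | hf) x y hxy hx
    · rw [hab, Sym2.eq_iff] at hxy
      rcases hxy with ⟨rfl, rfl⟩ | ⟨rfl, rfl⟩
      · exact Or.inr .rfl
      · exact Or.inl .rfl
    · exact hx.imp (fun h => h.trans (reachable_of_mem hf hxy))
        fun h => h.trans (reachable_of_mem hf hxy)
  · rintro (h | h)
    · exact h.mono (sub_mono (Set.subset_insert e H))
    · exact (reachable_of_mem (Set.mem_insert e H) hab).trans
        (h.mono (sub_mono (Set.subset_insert e H)))

theorem connected_sdiff_of_reachable {H : Set G.edgeSet} {e : G.edgeSet} {a b : V}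
    (hab : (e : Sym2 V) = s(a, b)) (hH : (sub H).Connected)
    (h : (sub (H \ {e})).Reachable a b) : (sub (H \ {e})).Connected := by
  rw [sub_sdiff, hab] at h ⊢
  exact hH.connected_delete_edge_of_not_isBridge fun hb => SimpleGraph.isBridge_iff.1 hb h

theorem connected_sdiff_of_isCycle {H : Set G.edgeSet} (hH : (sub H).Connected) {v : V}
    {p : (sub H).Walk v v} (hp : p.IsCycle) {e : G.edgeSet} (he : (e : Sym2 V) ∈ p.edges) :
    (sub (H \ {e})).Connected := by
  obtain ⟨a, b, hab⟩ := exists_eq_mk e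
  rw [sub_sdiff, hab]
  rw [hab] at he
  exact hH.connected_delete_edge_of_not_isBridge fun hb => hb.notMem_edges_of_isCycle hp he

theorem not_reachable_of_isAcyclic {H : Set G.edgeSet} (hH : (sub H).IsAcyclic) {e : G.edgeSet}
    (he : e ∈ H) {a b : V} (hab : (e : Sym2 V) = s(a, b)) :
    ¬ (sub (H \ {e})).Reachable a b := by
  have h := SimpleGraph.isAcyclic_iff_forall_isBridge.1 hH (mem_edgeSet_sub.2 he)
  rw [hab, SimpleGraph.isBridge_iff] at h
  rwa [sub_sdiff, hab]

/-! ### Sets of edges without broken circuits -/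

theorem IsNBC.mono {ord : G.edgeSet ↪ ℕ} {H H' : Set G.edgeSet} (h : IsNBC ord H')
    (hH : H ⊆ H') : IsNBC ord H :=
  fun B hB hs => h B hB (hs.trans hH)

theorem IsNBC.isAcyclic [Finite V] {ord : G.edgeSet ↪ ℕ} {H : Set G.edgeSet} (h : IsNBC ord H) :
    (sub H).IsAcyclic := by
  intro v p hp
  set C : Set G.edgeSet := {e | (e : Sym2 V) ∈ p.edges} with hC
  have hCH : C ⊆ H := fun e he => mem_edgeSet_sub.1 (p.edges_subset_edgeSet he)
  have hsub : ∀ e ∈ p.edges, e ∈ G.edgeSet := fun e he =>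
    SimpleGraph.edgeSet_mono (sub_le H) (p.edges_subset_edgeSet he)
  have hne : C.Nonempty := by
    have h3 := hp.three_le_length
    rw [← SimpleGraph.Walk.length_edges] at h3
    obtain ⟨e, he⟩ := List.exists_mem_of_length_pos (l := p.edges) (by omega)
    exact ⟨⟨e, hsub e he⟩, he⟩
  obtain ⟨e, he, hmin⟩ := Set.exists_min_image C ord (Set.toFinite _) hne
  refine h (C \ {e}) ⟨C, e, ⟨v, p.mapLe (sub_le H), hp.mapLe _, ?_⟩, ⟨he, hmin⟩, rfl⟩
    (Set.sdiff_subset.trans hCH)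
  ext f
  simp only [Set.mem_image, SimpleGraph.Walk.edges_mapLe_eq_edges]
  constructor
  · rintro ⟨g, hg, rfl⟩
    exact hg
  · exact fun hf => ⟨⟨f, hsub f hf⟩, hf, rfl⟩

/-! ### Minimal connected spanning subgraphs -/

/-- Exchange property: an edge `e` of a spanning tree `T` outside the connected spanning subgraph
`T'` can be exchanged with an edge of `T'` outside `T` that crosses the cut of `e`. -/
theorem exists_exchange {T T' : Set G.edgeSet} (hT : (sub T).IsTree) (hT' : (sub T').Connected)
    {e : G.edgeSet} (he : e ∈ T) (he' : e ∉ T') :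
    ∃ f ∈ T', f ∉ T ∧ f ∈ cut T e ∧ (sub (insert e (T' \ {f}))).Connected := by
  obtain ⟨a, b, hab⟩ := exists_eq_mk e
  have hnot := not_reachable_of_isAcyclic hT.isAcyclic he hab
  have hTe : insert e (T \ {e}) = T := by
    rw [Set.insert_sdiff_singleton, Set.insert_eq_of_mem he]
  obtain ⟨p, hp⟩ := hT'.exists_isPath a b
  obtain ⟨d, hd, hx, hy⟩ := p.exists_boundary_dart {x | (sub (T \ {e})).Reachable a x} .rfl hnot
  have hx : (sub (T \ {e})).Reachable a d.fst := hx
  have hy : ¬ (sub (T \ {e})).Reachable a d.snd := hy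
  obtain ⟨f, hf, hfd⟩ := sub_adj.1 d.adj
  have hfe : f ≠ e := fun h => he' (h ▸ hf)
  have hfT : f ∉ T := fun h =>
    hy (hx.trans (reachable_of_mem (H := T \ {e}) ⟨h, hfe⟩ hfd))
  refine ⟨f, hf, hfT, ?_, ?_⟩
  · have hyb : (sub (T \ {e})).Reachable b d.snd := by
      have h1 : (sub (insert e (T \ {e}))).Reachable a d.snd := by
        rw [hTe]
        exact hT.connected a d.snd
      exact ((reachable_insert_iff hab).1 h1).resolve_left hy
    have hle := sub_mono (Set.subset_insert f (T \ {e}))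
    have h1 : (sub (insert f (T \ {e}))).Reachable a b :=
      (hx.mono hle).trans ((reachable_of_mem (Set.mem_insert f _) hfd).trans (hyb.mono hle).symm)
    have h2 : insert f T \ {e} = insert f (T \ {e}) :=
      Set.insert_sdiff_of_notMem _ (by simpa using hfe)
    have h3 := connected_sdiff_of_reachable (H := insert f T) hab
      (hT.connected.mono (sub_mono (Set.subset_insert f T))) (by rwa [h2])
    rwa [h2] at h3
  · have hle := sub_mono (Set.subset_insert e T')
    have hep : s(b, a) ∉ (p.mapLe hle).edges := by
      rw [SimpleGraph.Walk.edges_mapLe_eq_edges, Sym2.eq_swap, ← hab]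
      exact fun h => he' (mem_edgeSet_sub.1 (p.edges_subset_edgeSet h))
    have hadj : (sub (insert e T')).Adj b a :=
      (sub_adj.2 ⟨e, Set.mem_insert e T', hab⟩).symm
    have hcyc := SimpleGraph.Path.cons_isCycle ⟨p.mapLe hle, hp.mapLe hle⟩ hadj hep
    have h1 := connected_sdiff_of_isCycle (hT'.mono hle) hcyc (e := f) (by
      rw [SimpleGraph.Walk.edges_cons, hfd]
      refine List.mem_cons_of_mem _ ?_
      rw [SimpleGraph.Walk.edges_mapLe_eq_edges]
      exact List.mem_map_of_mem (f := SimpleGraph.Dart.edge) hd)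
    rwa [Set.insert_sdiff_of_notMem _ (by simpa using hfe.symm)] at h1

section Weight

variable [Finite V]

/-- The weight of a set of edges in which the edge `e` weighs `2 ^ ord e`. Only the positivity of
these numbers and their order matter. -/
noncomputable def weight (ord : G.edgeSet ↪ ℕ) (T : Set G.edgeSet) : ℕ :=
  ∑ᶠ e ∈ T, 2 ^ ord e

theorem weight_insert (ord : G.edgeSet ↪ ℕ) {T : Set G.edgeSet} {e : G.edgeSet} (he : e ∉ T) :
    weight ord (insert e T) = 2 ^ ord e + weight ord T :=
  finsum_mem_insert _ he (Set.toFinite _)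

theorem weight_sdiff_add (ord : G.edgeSet ↪ ℕ) {T : Set G.edgeSet} {e : G.edgeSet} (he : e ∈ T) :
    2 ^ ord e + weight ord (T \ {e}) = weight ord T := by
  rw [← weight_insert ord (by simp), Set.insert_sdiff_singleton, Set.insert_eq_of_mem he]

theorem weight_insert_le (ord : G.edgeSet ↪ ℕ) (T : Set G.edgeSet) (e : G.edgeSet) :
    weight ord (insert e T) ≤ 2 ^ ord e + weight ord T := by
  by_cases he : e ∈ T
  · rw [Set.insert_eq_of_mem he]
    exact Nat.le_add_left _ _
  · exact (weight_insert ord he).le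

theorem weight_exchange (ord : G.edgeSet ↪ ℕ) {T : Set G.edgeSet} {e f : G.edgeSet} (hf : f ∈ T)
    (h : ord e < ord f) : weight ord (insert e (T \ {f})) < weight ord T := by
  have h1 := weight_insert_le ord (T \ {f}) e
  have h2 := weight_sdiff_add ord hf
  have h3 : 2 ^ ord e < 2 ^ ord f := Nat.pow_lt_pow_right (by norm_num) h
  omega

theorem weight_sdiff_lt (ord : G.edgeSet ↪ ℕ) {T : Set G.edgeSet} {f : G.edgeSet} (hf : f ∈ T) :
    weight ord (T \ {f}) < weight ord T := by
  have h2 := weight_sdiff_add ord hf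
  have h3 : 0 < 2 ^ ord f := by positivity
  omega

/-- `T` has the least weight among the sets of edges that contain `H` and connect all vertices. -/
structure IsMinSpanning (ord : G.edgeSet ↪ ℕ) (H T : Set G.edgeSet) : Prop where
  subset : H ⊆ T
  connected : (sub T).Connected
  weight_le : ∀ T', H ⊆ T' → (sub T').Connected → weight ord T ≤ weight ord T'

theorem exists_isMinSpanning (hG : G.Connected) (ord : G.edgeSet ↪ ℕ) (H : Set G.edgeSet) :
    ∃ T, IsMinSpanning ord H T := by
  obtain ⟨T, ⟨h1, h2⟩, h3⟩ := Set.exists_min_image {T | H ⊆ T ∧ (sub T).Connected} (weight ord)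
    (Set.toFinite _) ⟨Set.univ, Set.subset_univ H, by rwa [sub_univ]⟩
  exact ⟨T, h1, h2, fun T' h h' => h3 T' ⟨h, h'⟩⟩

theorem IsMinSpanning.isNBC {ord : G.edgeSet ↪ ℕ} {H T : Set G.edgeSet}
    (h : IsMinSpanning ord H T) (hH : IsNBC ord H) : IsNBC ord T := by
  rintro _ ⟨C, e, ⟨v, p, hp, hC⟩, ⟨he, hmin⟩, rfl⟩ hT
  -- Some edge `f` of the broken circuit is not in `H`, so it can be exchanged with `e`.
  have hne : ¬ C \ {e} ⊆ H := fun hs =>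
    hH _ ⟨C, e, ⟨v, p, hp, hC⟩, ⟨he, hmin⟩, rfl⟩ hs
  obtain ⟨f, ⟨hfC, hfe⟩, hfH⟩ := Set.not_subset.1 hne
  have hfe : f ≠ e := hfe
  have hlt : ord e < ord f :=
    lt_of_le_of_ne (hmin f hfC) fun h' => hfe (ord.injective h').symm
  have hfT : f ∈ T := hT ⟨hfC, hfe⟩
  have hpe : ∀ x ∈ p.edges, x ∈ (sub (insert e T)).edgeSet := by
    intro x hx
    have hx' : x ∈ Subtype.val '' C := hC ▸ hx
    obtain ⟨g, hg, rfl⟩ := hx'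
    rw [mem_edgeSet_sub]
    by_cases hge : g = e
    · exact Or.inl hge
    · exact Or.inr (hT ⟨hg, hge⟩)
  have hfp : (f : Sym2 V) ∈ p.edges := by
    have : (f : Sym2 V) ∈ Subtype.val '' C := ⟨f, hfC, rfl⟩
    rw [hC] at this
    exact this
  have hcon := connected_sdiff_of_isCycle
    (h.connected.mono (sub_mono (Set.subset_insert e T)))
    (hp.transfer hpe) (e := f) (by rwa [SimpleGraph.Walk.edges_transfer])
  rw [Set.insert_sdiff_of_notMem _ (by simpa using hfe.symm)] at hcon
  refine (h.weight_le _ ?_ hcon).not_gt (weight_exchange ord hfT hlt)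
  intro g hg
  exact Or.inr ⟨h.subset hg, fun h' => hfH (h' ▸ hg)⟩

theorem IsMinSpanning.isNBCTree {ord : G.edgeSet ↪ ℕ} {H T : Set G.edgeSet}
    (h : IsMinSpanning ord H T) (hH : IsNBC ord H) : IsNBCTree ord T :=
  ⟨⟨h.connected, (h.isNBC hH).isAcyclic⟩, h.isNBC hH⟩

theorem IsMinSpanning.internallyInactive_subset {ord : G.edgeSet ↪ ℕ} {H T : Set G.edgeSet}
    (h : IsMinSpanning ord H T) : internallyInactive ord T ⊆ H := by
  rintro e ⟨heT, hne⟩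
  push Not at hne
  obtain ⟨f, hf, hlt⟩ := hne
  by_contra heH
  refine (h.weight_le _ ?_ hf).not_gt (weight_exchange ord heT hlt)
  intro g hg
  exact Or.inr ⟨h.subset hg, fun h' => heH (h' ▸ hg)⟩

/-- A spanning tree `T` whose edges outside `H` are all internally active is the only connected
spanning subgraph of least weight that contains `H`. -/
theorem IsMinSpanning.eq_of_isTree {ord : G.edgeSet ↪ ℕ} {H T T' : Set G.edgeSet}
    (h : IsMinSpanning ord H T') (hT : (sub T).IsTree)
    (h1 : internallyInactive ord T ⊆ H) (h2 : H ⊆ T) : T' = T := by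
  by_cases hs : T ⊆ T'
  · refine Set.Subset.antisymm (fun f hf => ?_) hs
    by_contra hfT
    refine (h.weight_le (T' \ {f}) ?_ ?_).not_gt (weight_sdiff_lt ord hf)
    · exact fun g hg => ⟨h.subset hg, fun h' => hfT (h' ▸ h2 hg)⟩
    · exact hT.connected.mono (sub_mono fun g hg => ⟨hs hg, fun h' => hfT (h' ▸ hg)⟩)
  · obtain ⟨e, he, he'⟩ := Set.not_subset.1 hs
    obtain ⟨f, hf, hfT, hcut, hcon⟩ := exists_exchange hT h.connected he he'
    exfalso
    have hact : ∀ f ∈ cut T e, ord e ≤ ord f := by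
      by_contra hna
      exact he' (h.subset (h1 ⟨he, hna⟩))
    have hlt : ord e < ord f :=
      lt_of_le_of_ne (hact f hcut) fun h' => hfT (ord.injective h' ▸ he)
    refine (h.weight_le _ ?_ hcon).not_gt (weight_exchange ord hf hlt)
    exact fun g hg => Or.inr ⟨h.subset hg, fun h' => hfT (h' ▸ h2 hg)⟩

/-- A connected spanning subgraph of least weight that contains `H`; if `H` has no broken circuit,
this is the only NBC tree `T` with `IN(T) ⊆ H ⊆ T`. The value is meaningful if `G` is connected. -/
noncomputable def minTree (ord : G.edgeSet ↪ ℕ) (H : Set G.edgeSet) : Set G.edgeSet :=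
  Classical.epsilon (IsMinSpanning ord H)

theorem isMinSpanning_minTree (hG : G.Connected) (ord : G.edgeSet ↪ ℕ) (H : Set G.edgeSet) :
    IsMinSpanning ord H (minTree ord H) :=
  Classical.epsilon_spec (exists_isMinSpanning hG ord H)

theorem minTree_eq (hG : G.Connected) {ord : G.edgeSet ↪ ℕ} {H T : Set G.edgeSet}
    (hT : (sub T).IsTree) (h1 : internallyInactive ord T ⊆ H) (h2 : H ⊆ T) : minTree ord H = T :=
  (isMinSpanning_minTree hG ord H).eq_of_isTree hT h1 h2

theorem weight_minTree_le (hG : G.Connected) (ord : G.edgeSet ↪ ℕ) {H H' : Set G.edgeSet}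
    (h : H ⊆ H') : weight ord (minTree ord H) ≤ weight ord (minTree ord H') :=
  (isMinSpanning_minTree hG ord H).weight_le _
    (h.trans (isMinSpanning_minTree hG ord H').subset) (isMinSpanning_minTree hG ord H').connected

/-- The weight of the tree of `H` determines this tree among the trees of the supersets of `H`. -/
theorem minTree_eq_of_weight_eq (hG : G.Connected) {ord : G.edgeSet ↪ ℕ} {H H' : Set G.edgeSet}
    (hH : IsNBC ord H) (h : H ⊆ H')
    (hw : weight ord (minTree ord H) = weight ord (minTree ord H')) :
    minTree ord H' = minTree ord H := by
  have h1 := isMinSpanning_minTree hG ord H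
  have h2 := isMinSpanning_minTree hG ord H'
  have h3 : IsMinSpanning ord H (minTree ord H') :=
    ⟨h.trans h2.subset, h2.connected, fun T hT hc => hw ▸ h1.weight_le T hT hc⟩
  exact h3.eq_of_isTree (h1.isNBCTree hH).1 h1.internallyInactive_subset h1.subset

end Weight

/-! ### The far side of an edge of a rooted spanning tree -/

/-- The vertices that the removal of the edge `e` from `T` separates from the root. -/
def far (T : Set G.edgeSet) (root : V) (e : G.edgeSet) : Set V :=
  {v | ¬ (sub (T \ {e})).Reachable root v}

theorem exists_mem_far {T : Set G.edgeSet} (hT : (sub T).IsTree) (root : V) {e : G.edgeSet}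
    (he : e ∈ T) : ∃ a b, (e : Sym2 V) = s(a, b) ∧ a ∉ far T root e ∧ b ∈ far T root e := by
  obtain ⟨a, b, hab⟩ := exists_eq_mk e
  have hnot := not_reachable_of_isAcyclic hT.isAcyclic he hab
  have h1 : (sub (insert e (T \ {e}))).Reachable a root := by
    rw [Set.insert_sdiff_singleton, Set.insert_eq_of_mem he]
    exact hT.connected a root
  rcases (reachable_insert_iff hab).1 h1 with h | h
  · exact ⟨a, b, hab, not_not.2 h.symm, fun h' => hnot (h.trans h')⟩
  · exact ⟨b, a, hab.trans Sym2.eq_swap, not_not.2 h.symm, fun h' => hnot (h.trans h').symm⟩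

/-- The endpoint of the edge `e` of the spanning tree `T` that is farther from the root. -/
noncomputable def child (T : Set G.edgeSet) (root : V) (e : G.edgeSet) : V :=
  @Classical.epsilon V ⟨root⟩ fun b => b ∈ (e : Sym2 V) ∧ b ∈ far T root e

theorem child_spec {T : Set G.edgeSet} (hT : (sub T).IsTree) (root : V) {e : G.edgeSet}
    (he : e ∈ T) : child T root e ∈ (e : Sym2 V) ∧ child T root e ∈ far T root e := by
  obtain ⟨a, b, hab, -, hb⟩ := exists_mem_far hT root he
  exact @Classical.epsilon_spec V (fun b => b ∈ (e : Sym2 V) ∧ b ∈ far T root e)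
    ⟨b, by simp [hab], hb⟩

theorem exists_eq_mk_child {T : Set G.edgeSet} (hT : (sub T).IsTree) (root : V) {e : G.edgeSet}
    (he : e ∈ T) : ∃ a, (e : Sym2 V) = s(a, child T root e) ∧ a ∉ far T root e := by
  obtain ⟨a, b, hab, ha, hb⟩ := exists_mem_far hT root he
  obtain ⟨h1, h2⟩ := child_spec hT root he
  rw [hab, Sym2.mem_iff] at h1
  rcases h1 with h1 | h1
  · exact absurd (h1 ▸ h2) ha
  · exact ⟨a, h1 ▸ hab, ha⟩

/-- The far sides of two edges are nested if one edge lies on the far side of the other. -/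
theorem far_ssubset {T : Set G.edgeSet} (hT : (sub T).IsTree) (root : V) {e f : G.edgeSet}
    (hf : f ∈ T) (hef : e ≠ f) {u : V} (huf : u ∈ (f : Sym2 V))
    (hue : u ∈ far T root e) : far T root f ⊂ far T root e := by
  have hfe : f ∈ T \ {e} := ⟨hf, hef.symm⟩
  have key : ∀ y ∈ (f : Sym2 V), y ∈ far T root e := fun y hy h =>
    hue (h.trans (reachable_of_mem_of_mem hfe hy huf))
  rw [Set.ssubset_iff_of_subset]
  · obtain ⟨a, ha, hna⟩ := exists_eq_mk_child hT root hf
    exact ⟨a, key a (by simp [ha]), hna⟩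
  · intro x hx h
    refine hx (reachable_closed (fun y => (sub (T \ {f})).Reachable root y ∧
      (sub (T \ {e})).Reachable root y) ?_ h ⟨.rfl, .rfl⟩).1
    rintro g hg y z hyz ⟨h1, h2⟩
    refine ⟨h1.trans (reachable_of_mem (H := T \ {f}) ⟨hg.1, ?_⟩ hyz),
      h2.trans (reachable_of_mem hg hyz)⟩
    rintro rfl
    exact key y (by simp [hyz]) h2

/-- Every component of `H ⊆ T` that does not contain the root is left through an edge of `T`
whose far endpoint lies in this component. -/
theorem exists_reachable_child {T : Set G.edgeSet} (hT : (sub T).IsTree) {root : V}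
    {H : Set G.edgeSet} {v : V} (hv : ¬ (sub H).Reachable v root) :
    ∃ e ∈ T, e ∉ H ∧ (sub H).Reachable v (child T root e) := by
  obtain ⟨p, hp⟩ := hT.connected.exists_isPath v root
  induction p with
  | nil => exact absurd .rfl hv
  | @cons v u w hadj p ih =>
    rw [SimpleGraph.Walk.cons_isPath_iff] at hp
    obtain ⟨e, he, hab⟩ := sub_adj.1 hadj
    by_cases heH : e ∈ H
    · have hvu := reachable_of_mem heH hab
      obtain ⟨f, hf, hfH, h⟩ := ih (fun h => hv (hvu.trans h)) hp.1
      exact ⟨f, hf, hfH, hvu.trans h⟩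
    · refine ⟨e, he, heH, ?_⟩
      obtain ⟨h1, h2⟩ := child_spec hT w he
      rw [hab, Sym2.mem_iff] at h1
      rcases h1 with h1 | h1
      · rw [h1]
      · exfalso
        rw [h1] at h2
        refine h2 ?_
        rw [sub_sdiff]
        refine ⟨(p.toDeleteEdges {(e : Sym2 V)} ?_).reverse⟩
        rintro x hx rfl
        rw [hab] at hx
        exact hp.2 (p.fst_mem_support_of_mem_edges hx)

/-- An injective numbering of the edges of the rooted spanning tree `T` from the leaves to the
root. -/
noncomputable def rank (ord : G.edgeSet ↪ ℕ) (T : Set G.edgeSet) (root : V) (e : G.edgeSet) :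
    ℕ ×ₗ ℕ :=
  toLex ((far T root e).ncard, ord e)

theorem rank_injective (ord : G.edgeSet ↪ ℕ) (T : Set G.edgeSet) (root : V) :
    Function.Injective (rank ord T root) := by
  intro e f h
  exact ord.injective (congrArg (fun x => (ofLex x).2) h)

/-- In `H ⊆ T \ {e}`, the component of the far endpoint of `e` only meets edges of `T` that precede
`e`, apart from `e` itself. -/
theorem rank_lt_rank [Finite V] (ord : G.edgeSet ↪ ℕ) {T H : Set G.edgeSet} (hT : (sub T).IsTree)
    (root : V) {e f : G.edgeSet} (he : e ∈ T) (hf : f ∈ T) (hef : e ≠ f) (hH : H ⊆ T) (heH : e ∉ H)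
    {u : V} (huf : u ∈ (f : Sym2 V)) (hu : (sub H).Reachable (child T root e) u) :
    rank ord T root f < rank ord T root e := by
  have hsub : H ⊆ T \ {e} := fun g hg => ⟨hH hg, fun h => heH (h ▸ hg)⟩
  have hue : u ∈ far T root e := fun h =>
    (child_spec hT root he).2 (h.trans (hu.mono (sub_mono hsub)).symm)
  rw [rank, rank, Prod.Lex.toLex_lt_toLex]
  exact Or.inl (Set.ncard_lt_ncard (far_ssubset hT root hf hef huf hue) (Set.toFinite _))

/-! ### Colours of vertices and the differential -/

/-- The colour of a vertex, that is, of its component. -/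
def col {m : ℕ} (s : State G m) (v : V) : Fin m :=
  s.enh ((sub s.edges).connectedComponentMk v)

theorem col_eq_of_reachable {m : ℕ} {s : State G m} {v w : V} (h : (sub s.edges).Reachable v w) :
    col s v = col s w := by
  rw [col, col, SimpleGraph.ConnectedComponent.eq.2 h]

theorem state_ext {m : ℕ} {s t : State G m} (h : s.edges = t.edges)
    (hc : ∀ v, col s v = col t v) : s = t := by
  obtain ⟨H, f⟩ := s
  obtain ⟨H', g⟩ := t
  obtain rfl : H = H' := h
  congr
  funext C
  induction C using SimpleGraph.ConnectedComponent.ind with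
  | h v => exact hc v

theorem isUnit_sign (ord : G.edgeSet ↪ ℕ) (H : Set G.edgeSet) (e : G.edgeSet) :
    IsUnit (sign ord H e) :=
  isUnit_one.neg.pow _

section Step

variable [Fintype V]

open Classical in
theorem exponent_mk {m : ℕ} (s : State G m) {H' : Set G.edgeSet} (h : s.edges ⊆ H') (v : V) :
    exponent s H' ((sub H').connectedComponentMk v) =
      ∑ C : Comp s.edges with C.map (SimpleGraph.Hom.ofLE (sub_mono h)) =
        (sub H').connectedComponentMk v, (s.enh C : ℕ) := by
  unfold exponent
  simp only [supp_subset_iff h]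

theorem exponent_eq_col {m : ℕ} (s : State G m) {H' : Set G.edgeSet} (h : s.edges ⊆ H') {v : V}
    (hv : ∀ w, (sub H').Reachable v w → (sub s.edges).Reachable v w) :
    exponent s H' ((sub H').connectedComponentMk v) = col s v := by
  classical
  rw [exponent_mk s h, col]
  have : (Finset.univ.filter fun C : Comp s.edges => C.map (SimpleGraph.Hom.ofLE (sub_mono h)) =
      (sub H').connectedComponentMk v) = {(sub s.edges).connectedComponentMk v} := by
    ext C
    rw [Finset.mem_filter, Finset.mem_singleton]
    induction C using SimpleGraph.ConnectedComponent.ind with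
    | h w =>
      change _ ∧ (sub H').connectedComponentMk w = _ ↔ _
      rw [SimpleGraph.ConnectedComponent.eq, SimpleGraph.ConnectedComponent.eq]
      exact ⟨fun h' => (hv w h'.2.symm).symm, fun h' => ⟨Finset.mem_univ _, h'.mono (sub_mono h)⟩⟩
  rw [this, Finset.sum_singleton]

theorem exponent_insert {m : ℕ} (s : State G m) {e : G.edgeSet} {a b : V}
    (hab : (e : Sym2 V) = s(a, b)) (hn : ¬ (sub s.edges).Reachable a b) :
    exponent s (insert e s.edges) ((sub (insert e s.edges)).connectedComponentMk a) =
      (col s a : ℕ) + col s b := by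
  classical
  have h := Set.subset_insert e s.edges
  rw [exponent_mk s h, col, col]
  have : (Finset.univ.filter fun C : Comp s.edges => C.map (SimpleGraph.Hom.ofLE (sub_mono h)) =
      (sub (insert e s.edges)).connectedComponentMk a) =
      {(sub s.edges).connectedComponentMk a, (sub s.edges).connectedComponentMk b} := by
    ext C
    rw [Finset.mem_filter, Finset.mem_insert, Finset.mem_singleton]
    induction C using SimpleGraph.ConnectedComponent.ind with
    | h w =>
      change _ ∧ (sub (insert e s.edges)).connectedComponentMk w = _ ↔ _
      rw [SimpleGraph.ConnectedComponent.eq, SimpleGraph.ConnectedComponent.eq,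
        SimpleGraph.ConnectedComponent.eq, SimpleGraph.reachable_comm, reachable_insert_iff hab,
        SimpleGraph.reachable_comm (u := w), SimpleGraph.reachable_comm (u := w)]
      exact ⟨fun h' => h'.2, fun h' => ⟨Finset.mem_univ _, h'⟩⟩
  rw [this, Finset.sum_pair]
  rwa [Ne, SimpleGraph.ConnectedComponent.eq]

/-- The state `s'` arises from `s` by adding the edge `e`, with a nonzero product of colours. -/
structure IsStep {m : ℕ} (s s' : State G m) (e : G.edgeSet) : Prop where
  notMem : e ∉ s.edges
  edges_eq : s'.edges = insert e s.edges
  exponent_eq : ∀ v, exponent s s'.edges ((sub s'.edges).connectedComponentMk v) = col s' v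

theorem IsStep.mem {m : ℕ} {s s' : State G m} {e : G.edgeSet} (h : IsStep s s' e) :
    e ∈ s'.edges := by
  rw [h.edges_eq]
  exact Set.mem_insert e _

theorem IsStep.subset {m : ℕ} {s s' : State G m} {e : G.edgeSet} (h : IsStep s s' e) :
    s.edges ⊆ s'.edges := by
  rw [h.edges_eq]
  exact Set.subset_insert e _

theorem IsStep.edges_eq_sdiff {m : ℕ} {s s' : State G m} {e : G.edgeSet} (h : IsStep s s' e) :
    s.edges = s'.edges \ {e} := by
  rw [h.edges_eq, Set.insert_sdiff_self_of_notMem h.notMem]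

theorem IsStep.edge_unique {m : ℕ} {s s' : State G m} {e f : G.edgeSet} (h : IsStep s s' e)
    (h' : IsStep s s' f) : e = f := by
  have := h.mem
  rw [h'.edges_eq] at this
  exact this.resolve_right h.notMem

theorem IsStep.target_unique {m : ℕ} {s s₁ s₂ : State G m} {e : G.edgeSet} (h₁ : IsStep s s₁ e)
    (h₂ : IsStep s s₂ e) : s₁ = s₂ := by
  have hedges : s₁.edges = s₂.edges := h₁.edges_eq.trans h₂.edges_eq.symm
  refine state_ext hedges fun v => Fin.ext ?_
  rw [← h₁.exponent_eq, ← h₂.exponent_eq, hedges]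

theorem IsStep.col_eq {m : ℕ} {s s' : State G m} {e : G.edgeSet} (h : IsStep s s' e) {v : V}
    (hv : ∀ u ∈ (e : Sym2 V), ¬ (sub s.edges).Reachable v u) : col s' v = col s v := by
  refine Fin.ext ?_
  rw [← h.exponent_eq]
  refine exponent_eq_col s h.subset fun w hw => ?_
  rw [h.edges_eq] at hw
  exact (reachable_insert_iff_of_forall_not hv).1 hw

theorem IsStep.col_eq_add {m : ℕ} {s s' : State G m} {e : G.edgeSet} (h : IsStep s s' e)
    {a b : V} (hab : (e : Sym2 V) = s(a, b)) (hn : ¬ (sub s.edges).Reachable a b) :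
    (col s' a : ℕ) = col s a + col s b := by
  rw [← h.exponent_eq, h.edges_eq]
  exact exponent_insert s hab hn

/-- A step is determined by its edge and its target if it joins a component of colour `1`. -/
theorem IsStep.source_unique {m : ℕ} {s₁ s₂ s' : State G m} {e : G.edgeSet} (h₁ : IsStep s₁ s' e)
    (h₂ : IsStep s₂ s' e) {a b : V} (hab : (e : Sym2 V) = s(a, b))
    (hn : ¬ (sub (s'.edges \ {e})).Reachable a b) (hc₁ : (col s₁ b : ℕ) = 0)
    (hc₂ : (col s₂ b : ℕ) = 0) : s₁ = s₂ := by
  have hedges : s₁.edges = s₂.edges := h₁.edges_eq_sdiff.trans h₂.edges_eq_sdiff.symm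
  have hn₁ := hn
  have hn₂ := hn
  rw [← h₁.edges_eq_sdiff] at hn₁
  rw [← h₂.edges_eq_sdiff] at hn₂
  refine state_ext hedges fun v => Fin.ext ?_
  by_cases hva : (sub s₁.edges).Reachable v a
  · have e₁ := h₁.col_eq_add hab hn₁
    have e₂ := h₂.col_eq_add hab hn₂
    have hva₂ : (sub s₂.edges).Reachable v a := hedges ▸ hva
    rw [col_eq_of_reachable hva, col_eq_of_reachable hva₂]
    omega
  by_cases hvb : (sub s₁.edges).Reachable v b
  · have hvb₂ : (sub s₂.edges).Reachable v b := hedges ▸ hvb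
    rw [col_eq_of_reachable hvb, col_eq_of_reachable hvb₂, hc₁, hc₂]
  have hv : ∀ u ∈ (e : Sym2 V), ¬ (sub s₁.edges).Reachable v u := by
    intro u hu
    rw [hab, Sym2.mem_iff] at hu
    rcases hu with rfl | rfl <;> assumption
  rw [← h₁.col_eq hv, ← h₂.col_eq (by rwa [← hedges])]

/-- Joining a component of colour `1` is always possible. -/
theorem exists_isStep_of_col_eq_zero {m : ℕ} (s : State G m) {e : G.edgeSet} (he : e ∉ s.edges)
    {a b : V} (hab : (e : Sym2 V) = s(a, b)) (hn : ¬ (sub s.edges).Reachable a b)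
    (hb : (col s b : ℕ) = 0) : ∃ s', IsStep s s' e := by
  have hlt : ∀ C', exponent s (insert e s.edges) C' < m := by
    intro C'
    induction C' using SimpleGraph.ConnectedComponent.ind with
    | h v =>
      by_cases hv : (sub (insert e s.edges)).Reachable a v
      · rw [← SimpleGraph.ConnectedComponent.eq.2 hv, exponent_insert s hab hn, hb, add_zero]
        exact (col s a).2
      · rw [exponent_eq_col s (Set.subset_insert e _)]
        · exact (col s v).2
        · intro w hw
          refine (reachable_insert_iff_of_forall_not fun u hu h => hv ?_).1 hw
          refine SimpleGraph.Reachable.trans ?_ (h.mono (sub_mono (Set.subset_insert e _))).symm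
          exact reachable_of_mem_of_mem (Set.mem_insert e _) (by simp [hab]) hu
  exact ⟨⟨insert e s.edges, fun C' => ⟨_, hlt C'⟩⟩, he, rfl, fun v => rfl⟩

open Classical in
/-- An edge whose removal disconnects its endpoints can be removed by splitting off a component
of colour `1`. -/
theorem exists_isStep_to {m : ℕ} (s' : State G m) {e : G.edgeSet} (he : e ∈ s'.edges)
    {a b : V} (hab : (e : Sym2 V) = s(a, b)) (hn : ¬ (sub (s'.edges \ {e})).Reachable a b) :
    ∃ s, IsStep s s' e ∧ (col s b : ℕ) = 0 := by
  have hm : 0 < m := (col s' a).pos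
  have hins : insert e (s'.edges \ {e}) = s'.edges := by
    rw [Set.insert_sdiff_singleton, Set.insert_eq_of_mem he]
  obtain ⟨s, hs, hcolb, hcol⟩ : ∃ s : State G m, s.edges = s'.edges \ {e} ∧
      (col s b : ℕ) = 0 ∧ ∀ v, ¬ (sub s.edges).Reachable v b → col s v = col s' v := by
    refine ⟨⟨s'.edges \ {e}, fun C =>
      if C = (sub (s'.edges \ {e})).connectedComponentMk b then ⟨0, hm⟩ else
        s'.enh (C.map (SimpleGraph.Hom.ofLE (sub_mono Set.sdiff_subset)))⟩, rfl, ?_, fun v hv => ?_⟩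
    · exact congrArg Fin.val (if_pos rfl)
    · exact if_neg fun h => hv (SimpleGraph.ConnectedComponent.eq.1 h)
  rw [← hs] at hins hn
  refine ⟨s, ⟨fun h => (hs ▸ h).2 rfl, hins.symm, fun v => ?_⟩, hcolb⟩
  rw [← hins]
  by_cases hv : (sub (insert e s.edges)).Reachable a v
  · rw [← SimpleGraph.ConnectedComponent.eq.2 hv, exponent_insert s hab hn, hcolb, add_zero,
      hcol a hn]
    refine congrArg Fin.val (col_eq_of_reachable ?_)
    rw [← hins]
    exact hv
  · have hnot : ∀ u ∈ (e : Sym2 V), ¬ (sub s.edges).Reachable v u := by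
      refine fun u hu h => hv ?_
      refine SimpleGraph.Reachable.trans ?_ (h.mono (sub_mono (Set.subset_insert e _))).symm
      exact reachable_of_mem_of_mem (Set.mem_insert e _) (by simp [hab]) hu
    rw [exponent_eq_col s (Set.subset_insert e _), hcol v (hnot b (by simp [hab]))]
    exact fun w hw => (reachable_insert_iff_of_forall_not hnot).1 hw

theorem push_apply_of_isStep {m : ℕ} {s s' : State G m} {e : G.edgeSet} (h : IsStep s s' e) :
    push s (insert e s.edges) s' = 1 := by
  have hlt : ∀ C', exponent s (insert e s.edges) C' < m := by
    rw [← h.edges_eq]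
    intro C'
    induction C' using SimpleGraph.ConnectedComponent.ind with
    | h v =>
      rw [h.exponent_eq]
      exact (col s' v).2
  unfold push
  rw [dif_pos hlt, (?_ : State.mk (insert e s.edges) _ = s'), Finsupp.single_eq_same]
  refine state_ext h.edges_eq.symm fun v => Fin.ext ?_
  rw [← h.exponent_eq, h.edges_eq]
  rfl

theorem isStep_of_push_apply_ne {m : ℕ} {s s' : State G m} {e : G.edgeSet} (he : e ∉ s.edges)
    (h : push s (insert e s.edges) s' ≠ 0) : IsStep s s' e := by
  unfold push at h
  split_ifs at h with hlt
  · rw [Finsupp.single_apply_ne_zero] at h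
    obtain ⟨rfl, -⟩ := h
    exact ⟨he, rfl, fun v => rfl⟩
  · exact absurd rfl h

/-- The incidence numbers of the chromatic complex are `0` and `±1`. -/
theorem diff_apply_of_isStep (ord : G.edgeSet ↪ ℕ) {m : ℕ} {s s' : State G m} {e : G.edgeSet}
    (h : IsStep s s' e) : diff ord m (Finsupp.single s 1) s' = sign ord s.edges e := by
  classical
  rw [show diff ord m (Finsupp.single s 1) = dState ord s by simp [diff], dState,
    Finsupp.finsetSum_apply, Finset.sum_eq_single e]
  · rw [if_neg h.notMem, Finsupp.smul_apply, push_apply_of_isStep h, smul_eq_mul, mul_one]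
  · intro f _ hfe
    split_ifs with hf
    · rfl
    · rw [Finsupp.smul_apply]
      by_contra hne
      exact hfe ((isStep_of_push_apply_ne hf fun h0 => hne (by rw [h0, smul_zero])).edge_unique h)
  · exact fun h' => absurd (Finset.mem_univ e) h'

theorem exists_isStep_of_diff_ne (ord : G.edgeSet ↪ ℕ) {m : ℕ} {s s' : State G m}
    (h : diff ord m (Finsupp.single s 1) s' ≠ 0) : ∃ e, IsStep s s' e := by
  classical
  rw [show diff ord m (Finsupp.single s 1) = dState ord s by simp [diff], dState,
    Finsupp.finsetSum_apply] at h
  obtain ⟨e, -, he⟩ := Finset.exists_ne_zero_of_sum_ne_zero h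
  split_ifs at he with hs
  · exact absurd rfl he
  · exact ⟨e, isStep_of_push_apply_ne hs fun h0 => he (by rw [Finsupp.smul_apply, h0, smul_zero])⟩

theorem nbcComplex_inc {ord : G.edgeSet ↪ ℕ} {m : ℕ} (s s' : (nbcComplex G ord m).Ω) :
    (nbcComplex G ord m).inc s s' = diff ord m (Finsupp.single (nbcState s) 1) (nbcState s') := by
  change diff ord m (Finsupp.mapDomain Subtype.val (Finsupp.single s 1)) (nbcState s') = _
  have h : Finsupp.mapDomain Subtype.val (Finsupp.single s (1 : ℤ)) =
      Finsupp.single (nbcState s) 1 := Finsupp.mapDomain_single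
  exact congrArg (fun x => diff ord m x (nbcState s')) h

theorem nbcComplex_inc_ne_zero_iff {ord : G.edgeSet ↪ ℕ} {m : ℕ} (s s' : (nbcComplex G ord m).Ω) :
    (nbcComplex G ord m).inc s s' ≠ 0 ↔ ∃ e, IsStep (nbcState s) (nbcState s') e := by
  rw [nbcComplex_inc]
  refine ⟨exists_isStep_of_diff_ne ord, ?_⟩
  rintro ⟨e, h⟩
  rw [diff_apply_of_isStep ord h]
  exact (isUnit_sign ord _ e).ne_zero

theorem isUnit_nbcComplex_inc {ord : G.edgeSet ↪ ℕ} {m : ℕ} {s s' : (nbcComplex G ord m).Ω}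
    {e : G.edgeSet} (h : IsStep (nbcState s) (nbcState s') e) :
    IsUnit ((nbcComplex G ord m).inc s s') := by
  rw [nbcComplex_inc, diff_apply_of_isStep ord h]
  exact isUnit_sign ord _ e

end Step

/-! ### Movable edges and pivots -/

section Pivot

/-- An internally active edge `e` of the tree of `s` is movable if it belongs to `s`, or if the far
endpoint of `e` has the colour `1 = x ^ 0`. -/
def IsMovable (ord : G.edgeSet ↪ ℕ) (root : V) {m : ℕ} (s : State G m) (e : G.edgeSet) : Prop :=
  e ∈ minTree ord s.edges \ internallyInactive ord (minTree ord s.edges) ∧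
    (e ∈ s.edges ∨ (col s (child (minTree ord s.edges) root e) : ℕ) = 0)

/-- The pivot of a state is its first movable edge, in the order from the leaves to the root. -/
def IsPivot (ord : G.edgeSet ↪ ℕ) (root : V) {m : ℕ} (s : State G m) (e : G.edgeSet) : Prop :=
  IsMovable ord root s e ∧ ∀ f, IsMovable ord root s f →
    rank ord (minTree ord s.edges) root e ≤ rank ord (minTree ord s.edges) root f

variable {ord : G.edgeSet ↪ ℕ} {root : V} {m : ℕ} {s s' : State G m} {e : G.edgeSet}

theorem IsPivot.unique {f : G.edgeSet} (he : IsPivot ord root s e) (hf : IsPivot ord root s f) :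
    e = f :=
  rank_injective _ _ _ (le_antisymm (he.2 f hf.1) (hf.2 e he.1))

variable [Fintype V]

theorem IsMovable.exists_isPivot (h : IsMovable ord root s e) : ∃ e, IsPivot ord root s e := by
  obtain ⟨f, hf, hmin⟩ := Set.exists_min_image {f | IsMovable ord root s f}
    (rank ord (minTree ord s.edges) root) (Set.toFinite _) ⟨e, h⟩
  exact ⟨f, hf, hmin⟩

theorem minTree_isNBCTree (hG : G.Connected) {H : Set G.edgeSet} (hH : IsNBC ord H) :
    IsNBCTree ord (minTree ord H) :=
  (isMinSpanning_minTree hG ord H).isNBCTree hH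

theorem subset_minTree (hG : G.Connected) (H : Set G.edgeSet) : H ⊆ minTree ord H :=
  (isMinSpanning_minTree hG ord H).subset

theorem internallyInactive_minTree_subset (hG : G.Connected) (H : Set G.edgeSet) :
    internallyInactive ord (minTree ord H) ⊆ H :=
  (isMinSpanning_minTree hG ord H).internallyInactive_subset

/-- The tree does not change if a movable edge is added or an internally active one removed. -/
theorem minTree_eq_of_interval (hG : G.Connected) {H H' : Set G.edgeSet} (hH : IsNBC ord H)
    (h1 : internallyInactive ord (minTree ord H) ⊆ H') (h2 : H' ⊆ minTree ord H) :
    minTree ord H' = minTree ord H :=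
  minTree_eq hG (minTree_isNBCTree hG hH).1 h1 h2

theorem IsStep.isMovable (hG : G.Connected) (h : IsStep s s' e)
    (hT : minTree ord s'.edges = minTree ord s.edges) : IsMovable ord root s' e := by
  refine ⟨⟨subset_minTree hG _ h.mem, fun hin => h.notMem ?_⟩, Or.inl h.mem⟩
  rw [hT] at hin
  exact internallyInactive_minTree_subset hG _ hin

/-- Adding an edge without changing the tree does not affect which of the preceding edges are
movable: their far endpoints lie in components that the new edge does not meet. -/
theorem IsStep.isMovable_iff (hG : G.Connected) (h : IsStep s s' e) (hs : IsNBC ord s.edges)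
    (hT : minTree ord s'.edges = minTree ord s.edges) {f : G.edgeSet}
    (hf : rank ord (minTree ord s.edges) root f < rank ord (minTree ord s.edges) root e) :
    IsMovable ord root s' f ↔ IsMovable ord root s f := by
  have hfe : f ≠ e := by
    rintro rfl
    exact lt_irrefl _ hf
  unfold IsMovable
  rw [hT]
  refine and_congr_right fun hfT => ?_
  by_cases hfs : f ∈ s.edges
  · exact iff_of_true (Or.inl (h.subset hfs)) (Or.inl hfs)
  have hfs' : f ∉ s'.edges := by
    rw [h.edges_eq]
    rintro (h' | h')
    exacts [hfe h', hfs h']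
  rw [h.col_eq]
  · simp only [hfs, hfs', false_or]
  · intro u hu hr
    have heT : e ∈ minTree ord s.edges := hT ▸ subset_minTree hG _ h.mem
    exact lt_asymm hf (rank_lt_rank ord (minTree_isNBCTree hG hs).1 root hfT.1 heT hfe
      (subset_minTree hG _) hfs hu hr)

theorem IsStep.isPivot (hG : G.Connected) (h : IsStep s s' e) (hs : IsNBC ord s.edges)
    (hT : minTree ord s'.edges = minTree ord s.edges) (he : IsPivot ord root s e) :
    IsPivot ord root s' e := by
  refine ⟨h.isMovable hG hT, fun f hf => ?_⟩
  by_contra hlt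
  rw [not_le, hT] at hlt
  exact (he.2 f ((h.isMovable_iff hG hs hT hlt).1 hf)).not_gt hlt

theorem IsPivot.minTree_eq (hG : G.Connected) (he : IsPivot ord root s e) (h : IsStep s s' e)
    (hs : IsNBC ord s.edges) : minTree ord s'.edges = minTree ord s.edges := by
  refine minTree_eq_of_interval hG hs ((internallyInactive_minTree_subset hG _).trans h.subset) ?_
  rw [h.edges_eq]
  exact Set.insert_subset he.1.1.1 (subset_minTree hG _)

theorem IsPivot.exists_step_from (hG : G.Connected) (hs : IsNBC ord s.edges)
    (he : IsPivot ord root s e) (hes : e ∉ s.edges) : ∃ s', IsStep s s' e := by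
  have hT := (minTree_isNBCTree hG hs).1
  obtain ⟨a, ha, -⟩ := exists_eq_mk_child hT root he.1.1.1
  refine exists_isStep_of_col_eq_zero s hes ha (fun h => ?_) (he.1.2.resolve_left hes)
  refine not_reachable_of_isAcyclic hT.isAcyclic he.1.1.1 ha (h.mono (sub_mono fun g hg => ?_))
  exact ⟨subset_minTree hG _ hg, fun h' => hes (h' ▸ hg)⟩

theorem IsPivot.exists_step_to (hG : G.Connected) (hs : IsNBC ord s'.edges)
    (he : IsPivot ord root s' e) (hes : e ∈ s'.edges) :
    ∃ s, IsStep s s' e ∧ IsPivot ord root s e := by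
  have hT := (minTree_isNBCTree hG hs).1
  obtain ⟨a, ha, -⟩ := exists_eq_mk_child hT root he.1.1.1
  obtain ⟨s, h, hc⟩ := exists_isStep_to s' hes ha fun h => by
    refine not_reachable_of_isAcyclic hT.isAcyclic he.1.1.1 ha (h.mono (sub_mono fun g hg => ?_))
    exact ⟨subset_minTree hG _ hg.1, hg.2⟩
  have hsT : minTree ord s.edges = minTree ord s'.edges := by
    refine minTree_eq_of_interval hG hs ?_ (h.subset.trans (subset_minTree hG _))
    rw [h.edges_eq_sdiff]
    exact fun g hg => ⟨internallyInactive_minTree_subset hG _ hg, fun h' => he.1.1.2 (h' ▸ hg)⟩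
  refine ⟨s, h, ⟨?_, ?_⟩, fun f hf => ?_⟩
  · rw [hsT]
    exact he.1.1
  · rw [hsT]
    exact Or.inr hc
  · by_contra hlt
    rw [not_le] at hlt
    have hf' := he.2 f ((h.isMovable_iff hG (hs.mono h.subset) hsT.symm hlt).2 hf)
    rw [← hsT] at hf'
    exact hf'.not_gt hlt

end Pivot

/-! ### The matching -/

variable [Fintype V]
variable (ord : G.edgeSet ↪ ℕ) (root : V) (m : ℕ)

/-- The matching that pairs the states that differ by their common pivot, where the component split
off by its removal has the colour `1`. -/
def pivotMatching : Set ((nbcComplex G ord m).Ω × (nbcComplex G ord m).Ω) :=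
  {p | ∃ e, IsPivot ord root (nbcState p.1) e ∧ IsStep (nbcState p.1) (nbcState p.2) e}

variable {ord root m}

theorem isNBC_nbcState (s : (nbcComplex G ord m).Ω) : IsNBC ord (nbcState s).edges :=
  s.2

theorem nbcState_injective :
    Function.Injective (nbcState : (nbcComplex G ord m).Ω → State G m) :=
  Subtype.val_injective

theorem isCritical_pivotMatching_iff (hG : G.Connected) (s : (nbcComplex G ord m).Ω) :
    (nbcComplex G ord m).IsCritical (pivotMatching ord root m) s ↔
      ∀ e, ¬ IsMovable ord root (nbcState s) e := by
  have hs := isNBC_nbcState s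
  constructor
  · intro hc f hf
    obtain ⟨e, he⟩ := hf.exists_isPivot
    by_cases hes : e ∈ (nbcState s).edges
    · obtain ⟨t, ht, hte⟩ := he.exists_step_to hG hs hes
      exact (hc (⟨t, hs.mono ht.subset⟩, s) ⟨e, hte, ht⟩).2 rfl
    · obtain ⟨t, ht⟩ := he.exists_step_from hG hs hes
      have hT := he.minTree_eq hG ht hs
      have htn : IsNBC ord t.edges :=
        (minTree_isNBCTree hG hs).2.mono (hT ▸ subset_minTree hG t.edges)
      exact (hc (s, ⟨t, htn⟩) ⟨e, he, ht⟩).1 rfl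
  · rintro h ⟨t, t'⟩ ⟨e, he, hstep⟩
    constructor
    · rintro rfl
      exact h e he.1
    · rintro rfl
      have ht := isNBC_nbcState t
      exact h e (hstep.isMovable hG (he.minTree_eq hG hstep ht))

open Classical in
/-- The rank of the pivot, `⊤` if there is no movable edge. -/
noncomputable def pivotRank (ord : G.edgeSet ↪ ℕ) (root : V) (s : State G m) :
    WithTop (ℕ ×ₗ ℕ) :=
  (Finset.univ.filter (IsMovable ord root s)).inf
    fun e => (rank ord (minTree ord s.edges) root e : WithTop (ℕ ×ₗ ℕ))

theorem le_pivotRank_iff {s : State G m} {x : ℕ ×ₗ ℕ} :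
    (x : WithTop (ℕ ×ₗ ℕ)) ≤ pivotRank ord root s ↔
      ∀ f, IsMovable ord root s f → x ≤ rank ord (minTree ord s.edges) root f := by
  classical
  rw [pivotRank, Finset.le_inf_iff]
  simp

theorem IsPivot.pivotRank_eq {s : State G m} {e : G.edgeSet} (he : IsPivot ord root s e) :
    pivotRank ord root s = rank ord (minTree ord s.edges) root e := by
  classical
  refine le_antisymm ?_ (le_pivotRank_iff.2 he.2)
  exact Finset.inf_le (f := fun e => (rank ord (minTree ord s.edges) root e : WithTop (ℕ ×ₗ ℕ)))
    (Finset.mem_filter.2 ⟨Finset.mem_univ e, he.1⟩)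

/-- A quantity that strictly increases along all arrows after the arrows of the matching are
reversed. -/
noncomputable def potential (ord : G.edgeSet ↪ ℕ) (root : V) (s : State G m) :
    ℕ ×ₗ (WithTop (ℕ ×ₗ ℕ))ᵒᵈ ×ₗ ℕ ×ₗ ℕᵒᵈ :=
  toLex (weight ord (minTree ord s.edges), toLex (OrderDual.toDual (pivotRank ord root s),
    toLex ({f ∈ s.edges | ¬ IsPivot ord root s f}.ncard, OrderDual.toDual s.edges.ncard)))

theorem potential_lt_of_isPivot (hG : G.Connected) {s s' : State G m} {e : G.edgeSet}
    (hs : IsNBC ord s.edges) (he : IsPivot ord root s e) (h : IsStep s s' e) :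
    potential ord root s' < potential ord root s := by
  have hT := he.minTree_eq hG h hs
  have he' := h.isPivot hG hs hT he
  have hset : {f ∈ s'.edges | ¬ IsPivot ord root s' f} =
      {f ∈ s.edges | ¬ IsPivot ord root s f} := by
    ext f
    have h1 : IsPivot ord root s' f ↔ e = f :=
      ⟨fun hf => he'.unique hf, fun hf => hf ▸ he'⟩
    have h2 : IsPivot ord root s f ↔ e = f :=
      ⟨fun hf => he.unique hf, fun hf => hf ▸ he⟩
    simp only [Set.mem_ofPred_eq, h1, h2, h.edges_eq, Set.mem_insert_iff]
    refine and_congr_left fun hne => or_iff_right fun h' => hne h'.symm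
  rw [potential, potential, he'.pivotRank_eq, he.pivotRank_eq, hT, hset, Prod.Lex.toLex_lt_toLex]
  refine Or.inr ⟨rfl, Prod.Lex.toLex_lt_toLex.2 (Or.inr ⟨rfl, Prod.Lex.toLex_lt_toLex.2
    (Or.inr ⟨rfl, ?_⟩)⟩)⟩
  refine OrderDual.toDual_lt_toDual.2 ?_
  rw [h.edges_eq, Set.ncard_insert_of_notMem h.notMem (Set.toFinite _)]
  exact Nat.lt_succ_self _

theorem potential_lt_of_isStep (hG : G.Connected) {s s' : State G m} {e : G.edgeSet}
    (hs : IsNBC ord s.edges) (h : IsStep s s' e) (he : ¬ IsPivot ord root s e) :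
    potential ord root s < potential ord root s' := by
  rw [potential, potential, Prod.Lex.toLex_lt_toLex]
  rcases (weight_minTree_le hG ord h.subset).lt_or_eq with hw | hw
  · exact Or.inl hw
  refine Or.inr ⟨hw, Prod.Lex.toLex_lt_toLex.2 ?_⟩
  have hT := minTree_eq_of_weight_eq hG hs h.subset hw
  have hmov : IsMovable ord root s' e := h.isMovable hG hT
  obtain ⟨f, hf⟩ := hmov.exists_isPivot
  have hfe := hf.2 e hmov
  rw [hT] at hfe
  rcases hfe.lt_or_eq with hlt | heq
  · -- The pivot `f` of `s'` precedes `e`, so it is also the pivot of `s`.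
    have hf' : IsPivot ord root s f := by
      refine ⟨(h.isMovable_iff hG hs hT hlt).1 hf.1, fun g hg => ?_⟩
      by_contra hgf
      rw [not_le] at hgf
      have := hf.2 g ((h.isMovable_iff hG hs hT (hgf.trans hlt)).2 hg)
      rw [hT] at this
      exact this.not_gt hgf
    refine Or.inr ⟨?_, Prod.Lex.toLex_lt_toLex.2 (Or.inl ?_)⟩
    · change OrderDual.toDual _ = OrderDual.toDual _
      rw [hf.pivotRank_eq, hf'.pivotRank_eq, hT]
    · have hne : e ≠ f := by
        rintro rfl
        exact lt_irrefl _ hlt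
      refine Set.ncard_lt_ncard ?_ (Set.toFinite _)
      rw [Set.ssubset_iff_of_subset]
      · exact ⟨e, ⟨h.mem, fun h' => hne (h'.unique hf)⟩, fun h' => h.notMem h'.1⟩
      · exact fun g hg => ⟨h.subset hg.1, fun h' => hg.2 (h'.unique hf ▸ hf')⟩
  · -- The pivot of `s'` is `e`, and the movable edges of `s` come after `e`.
    obtain rfl : f = e := rank_injective _ _ _ heq
    refine Or.inl (OrderDual.toDual_lt_toDual.2 ?_)
    rw [hf.pivotRank_eq, hT]
    have hle : ∀ g, IsMovable ord root s g →
        rank ord (minTree ord s.edges) root f ≤ rank ord (minTree ord s.edges) root g := by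
      intro g hg
      by_contra hgf
      rw [not_le] at hgf
      have := hf.2 g ((h.isMovable_iff hG hs hT hgf).2 hg)
      rw [hT] at this
      exact this.not_gt hgf
    refine lt_of_le_of_ne (le_pivotRank_iff.2 hle) fun heq' => ?_
    by_cases hex : ∃ g, IsMovable ord root s g
    · obtain ⟨g, hg⟩ := hex
      obtain ⟨p, hp⟩ := hg.exists_isPivot
      rw [hp.pivotRank_eq, WithTop.coe_inj] at heq'
      exact he (rank_injective _ _ _ heq' ▸ hp)
    · classical
      push Not at hex
      rw [pivotRank, Finset.filter_false_of_mem fun g _ => hex g, Finset.inf_empty] at heq'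
      exact WithTop.coe_ne_top heq'

theorem isAcyclicMatching_pivotMatching (hG : G.Connected) :
    (nbcComplex G ord m).IsAcyclicMatching (pivotMatching ord root m) where
  adj := by
    rintro ⟨s, s'⟩ ⟨e, -, h⟩
    exact (nbcComplex_inc_ne_zero_iff s s').2 ⟨e, h⟩
  isUnit := by
    rintro ⟨s, s'⟩ ⟨e, -, h⟩
    exact isUnit_nbcComplex_inc h
  disjoint := by
    rintro ⟨s, s'⟩ ⟨e, he, h⟩ ⟨t, t'⟩ ⟨f, hf, k⟩ hne
    dsimp only at he h hf k ⊢
    have hTs := he.minTree_eq hG h (isNBC_nbcState s)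
    have hTt := hf.minTree_eq hG k (isNBC_nbcState t)
    have he' := h.isPivot hG (isNBC_nbcState s) hTs he
    have hf' := k.isPivot hG (isNBC_nbcState t) hTt hf
    refine ⟨?_, ?_, ?_, ?_⟩
    · rintro rfl
      obtain rfl := he.unique hf
      exact hne (Prod.ext rfl (nbcState_injective (h.target_unique k)))
    · rintro rfl
      obtain rfl := he.unique hf'
      exact h.notMem k.mem
    · rintro rfl
      obtain rfl := hf.unique he'
      exact k.notMem h.mem
    · rintro rfl
      obtain rfl := he'.unique hf'
      refine hne (Prod.ext (nbcState_injective ?_) rfl)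
      have hT := (minTree_isNBCTree hG (isNBC_nbcState s')).1
      obtain ⟨a, ha, -⟩ := exists_eq_mk_child hT root he'.1.1.1
      refine h.source_unique k ha (fun hr => ?_) ?_ ?_
      · refine not_reachable_of_isAcyclic hT.isAcyclic he'.1.1.1 ha
          (hr.mono (sub_mono fun g hg => ?_))
        exact ⟨subset_minTree hG _ hg.1, hg.2⟩
      · rw [hTs]
        exact he.1.2.resolve_left h.notMem
      · rw [hTt]
        exact hf.1.2.resolve_left k.notMem
  acyclic := by
    have key : ∀ s t : (nbcComplex G ord m).Ω,
        ((nbcComplex G ord m).reversedGraph (pivotMatching ord root m)).Adj s t →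
          potential ord root (nbcState s) < potential ord root (nbcState t) := by
      rintro s t (⟨h, hM⟩ | ⟨e, he, h⟩)
      · obtain ⟨e, he⟩ := (nbcComplex_inc_ne_zero_iff s t).1 h
        exact potential_lt_of_isStep hG (isNBC_nbcState s) he fun hp => hM ⟨e, hp, he⟩
      · exact potential_lt_of_isPivot hG (isNBC_nbcState t) he h
    have key' : ∀ s t : (nbcComplex G ord m).Ω, Relation.TransGen
        ((nbcComplex G ord m).reversedGraph (pivotMatching ord root m)).Adj s t →
          potential ord root (nbcState s) < potential ord root (nbcState t) := by
      intro s t h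
      induction h with
      | single h => exact key _ _ h
      | tail _ h ih => exact ih.trans (key _ _ h)
    exact fun c h => lt_irrefl _ (key' c c h)

/-! ### The critical states -/

theorem mem_criticalStates_iff (hG : G.Connected) {T : Set G.edgeSet} (hT : IsNBCTree ord T)
    (s : (nbcComplex G ord m).Ω) :
    s ∈ criticalStates (pivotMatching ord root m) T ↔
      (nbcState s).edges = internallyInactive ord T ∧
        ∀ v, ¬ (sub (internallyInactive ord T)).Reachable v root →
          (col (nbcState s) v : ℕ) ≠ 0 := by
  have hTree : internallyInactive ord T ⊆ (nbcState s).edges → (nbcState s).edges ⊆ T →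
      minTree ord (nbcState s).edges = T := minTree_eq hG hT.1
  constructor
  · rintro ⟨hc, h1, h2⟩
    rw [isCritical_pivotMatching_iff hG] at hc
    have hmT := hTree h1 h2
    have hedges : (nbcState s).edges = internallyInactive ord T := by
      refine Set.Subset.antisymm (fun e he => ?_) h1
      by_contra hne
      refine hc e ⟨?_, Or.inl he⟩
      rw [hmT]
      exact ⟨h2 he, hne⟩
    refine ⟨hedges, fun v hv h0 => ?_⟩
    obtain ⟨e, he, heI, hr⟩ := exists_reachable_child hT.1 hv
    refine hc e ⟨?_, Or.inr ?_⟩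
    · rw [hmT]
      exact ⟨he, heI⟩
    · rw [hmT, ← col_eq_of_reachable (hedges ▸ hr), h0]
  · rintro ⟨hedges, hcol⟩
    have h1 : internallyInactive ord T ⊆ (nbcState s).edges := hedges.ge
    have h2 : (nbcState s).edges ⊆ T := hedges.le.trans fun e he => he.1
    have hmT := hTree h1 h2
    refine ⟨(isCritical_pivotMatching_iff hG s).2 ?_, h1, h2⟩
    rintro e ⟨he, hm⟩
    rw [hmT] at he hm
    rcases hm with hm | hm
    · exact he.2 (hedges ▸ hm)
    · refine hcol _ (fun hr => ?_) hm
      refine (child_spec hT.1 root he.1).2 (hr.symm.mono (sub_mono fun g hg => ?_))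
      exact ⟨hg.1, fun h => he.2 (h ▸ hg)⟩

theorem image_criticalStates (hG : G.Connected) {T : Set G.edgeSet} (hT : IsNBCTree ord T) :
    nbcState '' criticalStates (pivotMatching ord root m) T =
      (fun f => (⟨internallyInactive ord T, f⟩ : State G m)) ''
        {f | ∀ C, C ≠ (sub (internallyInactive ord T)).connectedComponentMk root →
          (f C : ℕ) ≠ 0} := by
  ext ⟨H, f⟩
  constructor
  · rintro ⟨s, hs, hsf⟩
    rw [mem_criticalStates_iff hG hT, hsf] at hs
    obtain ⟨hH, hcol⟩ := hs
    obtain rfl : H = internallyInactive ord T := hH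
    refine ⟨f, fun C hC => ?_, rfl⟩
    induction C using SimpleGraph.ConnectedComponent.ind with
    | h v => exact hcol v fun hr => hC (SimpleGraph.ConnectedComponent.eq.2 hr)
  · rintro ⟨g, hg, hgf⟩
    have hH : internallyInactive ord T = H := congrArg State.edges hgf
    have hN : IsNBC ord H := hT.2.mono (hH ▸ fun e he => he.1)
    refine ⟨⟨⟨H, f⟩, hN⟩, (mem_criticalStates_iff hG hT _).2 ⟨hH.symm, fun v hv => ?_⟩, rfl⟩
    change (col (⟨H, f⟩ : State G m) v : ℕ) ≠ 0
    rw [← hgf]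
    exact hg _ fun h => hv (SimpleGraph.ConnectedComponent.eq.1 h)

/-- The number of maps into `Fin m` that are nonzero off one point. -/
theorem ncard_nonzero_off {α : Type*} [Finite α] (r : α) (hm : 0 < m) :
    {f : α → Fin m | ∀ a, a ≠ r → (f a : ℕ) ≠ 0}.ncard = m * (m - 1) ^ (Nat.card α - 1) := by
  classical
  have := Fintype.ofFinite α
  have h : {f : α → Fin m | ∀ a, a ≠ r → (f a : ℕ) ≠ 0} =
      (Fintype.piFinset fun a : α =>
        if a = r then Finset.univ else Finset.univ.erase (⟨0, hm⟩ : Fin m) : Set (α → Fin m)) := by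
    ext f
    simp only [Set.mem_ofPred_eq, Finset.mem_coe, Fintype.mem_piFinset]
    refine forall_congr' fun a => ?_
    by_cases ha : a = r <;> simp [ha, Fin.ext_iff]
  rw [h, Set.ncard_coe_finset, Fintype.card_piFinset,
    ← Finset.mul_prod_erase Finset.univ _ (Finset.mem_univ r), if_pos rfl, Finset.card_univ,
    Fintype.card_fin, Finset.prod_congr rfl (g := fun _ => m - 1), Finset.prod_const,
    Finset.card_erase_of_mem (Finset.mem_univ r), Finset.card_univ, Nat.card_eq_fintype_card]
  intro a ha
  rw [if_neg (Finset.ne_of_mem_erase ha), Finset.card_erase_of_mem (Finset.mem_univ _),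
    Finset.card_univ, Fintype.card_fin]

end Chromatic

theorem theorem4 {V : Type*} [Fintype V] (G : SimpleGraph V) (hG : G.Connected)
    (ord : G.edgeSet ↪ ℕ) (root : V) (m : ℕ) (hm : 2 ≤ m) :
    ∃ M : Set ((Chromatic.nbcComplex G ord m).Ω × (Chromatic.nbcComplex G ord m).Ω),
      (Chromatic.nbcComplex G ord m).IsAcyclicMatching M ∧
      -- every critical state belongs to exactly one NBC spanning tree
      (∀ s, (Chromatic.nbcComplex G ord m).IsCritical M s →
        ∃! T : Set G.edgeSet, Chromatic.IsNBCTree ord T ∧ s ∈ Chromatic.criticalStates M T) ∧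
      ∀ T : Set G.edgeSet, Chromatic.IsNBCTree ord T →
        -- the critical states of `T` are the enhancements of `IN(T)` that do not take the
        -- value `1 = x ^ 0` on components other than that of the root
        Chromatic.nbcState '' Chromatic.criticalStates M T =
          (fun f => (⟨Chromatic.internallyInactive ord T, f⟩ : Chromatic.State G m)) ''
            {f | ∀ C, C ≠ (Chromatic.sub
              (Chromatic.internallyInactive ord T)).connectedComponentMk root →
                (f C : ℕ) ≠ 0} ∧
        (Chromatic.criticalStates M T).ncard =
          m * (m - 1) ^ (Nat.card (Chromatic.Comp (Chromatic.internallyInactive ord T)) - 1) := by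
  refine ⟨Chromatic.pivotMatching ord root m, Chromatic.isAcyclicMatching_pivotMatching hG,
    fun s hs => ⟨Chromatic.minTree ord (Chromatic.nbcState s).edges, ⟨?_, hs, ?_, ?_⟩, ?_⟩,
    fun T hT => ⟨Chromatic.image_criticalStates hG hT, ?_⟩⟩
  · exact Chromatic.minTree_isNBCTree hG (Chromatic.isNBC_nbcState s)
  · exact Chromatic.internallyInactive_minTree_subset hG _
  · exact Chromatic.subset_minTree hG _
  · rintro T ⟨hT, -, h1, h2⟩
    exact (Chromatic.minTree_eq hG hT.1 h1 h2).symm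
  · rw [← Set.ncard_image_of_injective _ Chromatic.nbcState_injective,
      Chromatic.image_criticalStates hG hT, Set.ncard_image_of_injective]
    · exact Chromatic.ncard_nonzero_off _ (by omega)
    · intro f g h
      simpa using h
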